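/- A \emph{pre-Kleene algebra} is an idempotent semiring with a unary operation ${}^*$ satisfying $x^* = 1 + x x^*$, ordered by $x \le y \iff x + y = y$. A \emph{commutable set} is a set $X$ with a reflexive symmetric relation $\sim$; it is \emph{discrete} if $\sim$ is equality. $\mathcal{S}X$ denotes the monoid of words over $X$ modulo swapping adjacent commuting symbols, and $\mathcal{T}X$ the pre-Kleene algebra freely generated by $X$ subject to $xy = yx$ whenever $x \sim y$; elements of $\mathcal{S}X$ (strings) are viewed as elements of $\mathcal{T}X$ (terms), and a finite set of strings is viewed as the sum of its elements. $|s|$ is the length of a string $s$. Let $X \oplus Y$ consist of symbols $x_l$ ($x \in X$) and $y_r$ ($y \in Y$), where $x_l \sim y_r$ and $y_r \sim x_l$ always hold, and $x_l \sim x'_l$ (resp. $y_r \sim y'_r$) iff $x \sim x'$ (resp. $y \sim y'$). Write $\ddot X = X \oplus X$. The maps $x \mapsto x_l$, $y \mapsto y_r$ extend to morphisms $(-)_l, (-)_r$ on strings and terms; $\pi_l$ is the morphism on strings and on terms with $\pi_l(x_l) = x$, $\pi_l(y_r) = 1$, and $\pi_r$ the one with $\pi_r(x_l) = 1$, $\pi_r(y_r)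 = y$. A term over $X$ is viewed as a term over $\ddot X$ by the morphism with $x \mapsto x_l x_r$. Let $[-]_0 : \mathcal{T}X \to \{0 \le 1\}$ be the morphism that sends every $x \in X$ to $0$. Let $\Sigma$ be a finite commutable set. \begin{itemize} \item $L \in \mathcal{T}\Sigma$ is \emph{prefix free} if, for all strings $s_1, s_2 \le L$ such that $s_1$ is a prefix of $s_2$, we have $s_1 = s_2$. \item For $X$ finite, a \emph{finite-state automaton} over $X$ is a finite set $S \subseteq \mathcal{T}X$ that contains $1$, is closed under finite sums (including the empty sum $0$), and is such that for every $e \in S$ there are terms $\delta_x(e) \in S$ ($x \in X$) with $e = [e]_0 + \sum_{x \in X} x\,\delta_x(e)$. A term is \emph{finite state} if it belongs to some finite-state automaton. \item $e \in \mathcal{T}\ddot\Sigma$ has \emph{bounded output} if there is $k \in \mathbb{N}$ such that $|\pi_r(s)| \le (|\pi_l(s)| + 1)k$ for every string $s \le e$. \item For $e \in \mathcal{T}\ddot\Sigma$ and $s, s' \in \mathcal{S}\Sigma$, write $s \to_e s'$ if $s_l s'_r \le e$, and for $\Lambda \subseteq \mathcal{S}\Sigma$ let $\mathrm{Next}_e(\Lambda)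 = \{ s' \mid \exists s \in \Lambda,\ s \to_e s' \}$. The term $e$ is a \emph{representable relation} on $L \in \mathcal{T}\Sigma$ if $\pi_l(e) \le L$; $\pi_r(e) \le L$; $\mathrm{Next}_e(\Lambda)$ is finite for every finite $\Lambda \subseteq \mathcal{S}\Sigma$; and there is a term $\rho \in \mathcal{T}\ddot\Sigma$ such that, for every finite set $\Lambda$ of strings all of which are $\le L$, \[ \Lambda_r\, e \;\le\; \Lambda\, \mathrm{Next}_e(\Lambda)_r + \Sigma^* \Sigma^{\ne} \rho, \qquad \Sigma^{\ne} = \sum_{x \ne y} x_l y_r . \] \end{itemize} A \emph{two-counter machine} $M = (Q_M, \dot q, \iota)$ consists of a finite set $Q_M$ of control states, an initial state $\dot q \in Q_M$, and a map $\iota$ from $Q_M$ to instructions of the form $\mathrm{Inc}(r,q)$, $\mathrm{If}(r,q_1,q_2)$ or $\mathrm{Halt}(x)$, with $r \in \{1,2\}$, $q, q_1, q_2 \in Q_M$, $x \in \{0,1\}$. Let $\Sigma_M$ be the discrete commutable set $Q_M + \{a, b, c_0, c_1\}$, and \[ C_M = a^* b^* Q_M \in \mathcal{T}\Sigma_M,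 \qquad T_M = C_M + \{c_0, c_1\} \in \mathcal{T}\Sigma_M . \] In $\mathcal{T}\ddot\Sigma_M$ put \begin{align*} [\![\mathrm{Inc}(1,q)]\!] &= a_r a^* b^* q_r, & [\![\mathrm{If}(1,q_1,q_2)]\!] &= b^* (q_1)_r + a_l a^* b^* (q_2)_r,\\ [\![\mathrm{Inc}(2,q)]\!] &= a^* b_r b^* q_r, & [\![\mathrm{If}(2,q_1,q_2)]\!] &= a^* (q_1)_r + a^* b_l b^* (q_2)_r,\\ [\![\mathrm{Halt}(x)]\!] &= (c_x)_r, & R_M &= \sum_{q \in Q_M} [\![\iota(q)]\!]\, q_l . \end{align*} \textbf{Lemma.} For every two-counter machine $M$: \begin{itemize} \item $T_M$ is prefix free; \item $\pi_l(R_M) \le C_M \le T_M$; \item $\pi_r(R_M) \le T_M$; \item $R_M$ is finite state; \item $R_M$ has bounded output; \item $R_M$ is a representable relation on $T_M$. \end{itemize} -/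

import Mathlib

open scoped Computability

namespace CommKA

universe u v w

/-! ## Pre-Kleene algebras -/

/-- A (left-biased) pre-Kleene algebra: an idempotent semiring with a star satisfying the left
unfolding rule. The order of an `IdemSemiring` is `x ≤ y ↔ x + y = y`. -/
class PreKleeneAlgebra (A : Type u) extends IdemSemiring A, KStar A where
  kstar_unfold : ∀ x : A, x∗ = 1 + x * x∗

/-- Morphisms of pre-Kleene algebras. -/
structure PreKAHom (A : Type u) (B : Type v) [PreKleeneAlgebra A] [PreKleeneAlgebra B]
    extends A →+* B where
  map_kstar' : ∀ x : A, toFun x∗ = (toFun x)∗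

namespace PreKAHom

variable {A : Type u} {B : Type v} [PreKleeneAlgebra A] [PreKleeneAlgebra B]

instance : FunLike (PreKAHom A B) A B where
  coe f := f.toRingHom
  coe_injective f g h := by
    cases f; cases g; congr; exact DFunLike.coe_injective h

instance : RingHomClass (PreKAHom A B) A B where
  map_mul f := f.toRingHom.map_mul
  map_one f := f.toRingHom.map_one
  map_add f := f.toRingHom.map_add
  map_zero f := f.toRingHom.map_zero

theorem map_kstar (f : PreKAHom A B) (x : A) : f x∗ = (f x)∗ := f.map_kstar' x

end PreKAHom

/-- The two-element pre-Kleene algebra `{0 ≤ 1}`: addition is disjunction, multiplication is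
conjunction and the star is constantly `1`. -/
inductive Two : Type
  | zero
  | one

namespace Two

instance : Zero Two := ⟨zero⟩

instance : One Two := ⟨one⟩

instance : Add Two where
  add
    | zero, y => y
    | one, _ => one

instance : Mul Two where
  mul
    | zero, _ => zero
    | one, y => y

instance : Semiring Two where
  add_assoc a b c := by cases a <;> cases b <;> cases c <;> rfl
  zero_add a := by cases a <;> rfl
  add_zero a := by cases a <;> rfl
  add_comm a b := by cases a <;> cases b <;> rfl
  left_distrib a b c := by cases a <;> cases b <;> cases c <;> rfl
  right_distrib a b c := by cases a <;> cases b <;> cases c <;> rfl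
  zero_mul a := by cases a <;> rfl
  mul_zero a := by cases a <;> rfl
  mul_assoc a b c := by cases a <;> cases b <;> cases c <;> rfl
  one_mul a := by cases a <;> rfl
  mul_one a := by cases a <;> rfl
  nsmul := nsmulRec

instance : PreKleeneAlgebra Two where
  __ := IdemSemiring.ofSemiring (α := Two) (fun a => by cases a <;> rfl)
  kstar _ := one
  kstar_unfold x := by cases x <;> rfl

/-- The inclusion of `{0, 1}` in a pre-Kleene algebra. -/
def toAlg {A : Type u} [PreKleeneAlgebra A] : Two → A
  | zero => 0
  | one => 1

end Two

/-! ## Commutable sets -/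

/-- A commutable set: a type with a reflexive symmetric relation. -/
class CommutableSet (X : Type u) where
  Commutes : X → X → Prop
  refl : ∀ x, Commutes x x
  symm : ∀ {x y}, Commutes x y → Commutes y x

open CommutableSet (Commutes)

/-- The commuting relation on `X ⊕ Y`: symbols of different sides commute, and symbols of the same
side commute if they do in the summand. -/
def SumCommutes {X : Type u} {Y : Type v} [CommutableSet X] [CommutableSet Y] :
    X ⊕ Y → X ⊕ Y → Prop
  | .inl x, .inl x' => Commutes x x'
  | .inr y, .inr y' => Commutes y y'
  | .inl _, .inr _ => True
  | .inr _, .inl _ => True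

instance {X : Type u} {Y : Type v} [CommutableSet X] [CommutableSet Y] :
    CommutableSet (X ⊕ Y) where
  Commutes := SumCommutes
  refl x := by
    cases x
    · exact CommutableSet.refl (X := X) _
    · exact CommutableSet.refl (X := Y) _
  symm {x y} h := by
    cases x <;> cases y
    · exact CommutableSet.symm (X := X) h
    · trivial
    · trivial
    · exact CommutableSet.symm (X := Y) h

/-! ## Strings -/

/-- The relation on words that swaps two commuting symbols. -/
inductive SwapRel (X : Type u) [CommutableSet X] : FreeMonoid X → FreeMonoid X → Prop
  | swap {x y : X} (h : Commutes x y) :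
      SwapRel X (FreeMonoid.of x * FreeMonoid.of y) (FreeMonoid.of y * FreeMonoid.of x)

/-- The monoid of strings over a commutable set: words modulo swaps of adjacent commuting
symbols. -/
abbrev Str (X : Type u) [CommutableSet X] : Type u := PresentedMonoid (SwapRel X)

namespace Str

variable {X : Type u} {Y : Type v} [CommutableSet X] [CommutableSet Y]

/-- A symbol as a string. -/
def sym (x : X) : Str X := PresentedMonoid.of (SwapRel X) x

theorem sym_comm {x y : X} (h : Commutes x y) : sym x * sym y = sym y * sym x :=
  (Con.eq (conGen (SwapRel X))).2 (ConGen.Rel.of _ _ (SwapRel.swap h))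

/-- The monoid morphism determined by its values on symbols. -/
def lift {M : Type w} [Monoid M] (f : X → M)
    (hf : ∀ x y, Commutes x y → f x * f y = f y * f x) : Str X →* M :=
  PresentedMonoid.lift f (by
    rintro _ _ ⟨h⟩
    simpa using hf _ _ h)

theorem lift_sym {M : Type w} [Monoid M] (f : X → M)
    (hf : ∀ x y, Commutes x y → f x * f y = f y * f x) (x : X) : lift f hf (sym x) = f x := by
  simp [lift, sym]

/-- The length of a string. -/
def size (s : Str X) : ℕ :=
  (lift (X := X) (fun _ => Multiplicative.ofAdd 1) (fun _ _ _ => rfl) s).toAdd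

/-- `s` is a prefix of `t`. -/
def IsPrefix (s t : Str X) : Prop := ∃ u, t = s * u

/-- The embedding `s ↦ s_l`. -/
def left : Str X →* Str (X ⊕ Y) :=
  lift (fun x => sym (.inl x)) (fun _ _ h => sym_comm (X := X ⊕ Y) h)

/-- The embedding `s ↦ s_r`. -/
def right : Str Y →* Str (X ⊕ Y) :=
  lift (fun y => sym (.inr y)) (fun _ _ h => sym_comm (X := X ⊕ Y) h)

/-- The projection `π_l`, which erases the right symbols. -/
def projL : Str (X ⊕ Y) →* Str X :=
  lift (Sum.elim sym (fun _ => 1)) (by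
    rintro (x | x) (y | y) h
    · exact sym_comm (X := X) h
    all_goals simp)

/-- The projection `π_r`, which erases the left symbols. -/
def projR : Str (X ⊕ Y) →* Str Y :=
  lift (Sum.elim (fun _ => 1) sym) (by
    rintro (x | x) (y | y) h
    · simp
    · simp
    · simp
    · exact sym_comm (X := Y) h)

end Str

/-! ## The free pre-Kleene algebra on a commutable set -/

/-- Expressions over the pre-Kleene algebra operations. -/
inductive RawTerm (X : Type u) : Type u
  | sym (x : X)
  | zero
  | one
  | add (e f : RawTerm X)
  | mul (e f : RawTerm X)
  | star (e : RawTerm X)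

/-- Provable equality of expressions: the congruence generated by the pre-Kleene algebra laws and
the commuting conditions. -/
inductive RawTerm.Eqv {X : Type u} [CommutableSet X] : RawTerm X → RawTerm X → Prop
  | refl (e) : Eqv e e
  | symm {e f} : Eqv e f → Eqv f e
  | trans {e f g} : Eqv e f → Eqv f g → Eqv e g
  | congr_add {e e' f f'} : Eqv e e' → Eqv f f' → Eqv (.add e f) (.add e' f')
  | congr_mul {e e' f f'} : Eqv e e' → Eqv f f' → Eqv (.mul e f) (.mul e' f')
  | congr_star {e e'} : Eqv e e' → Eqv (.star e) (.star e')
  | zero_add (e) : Eqv (.add .zero e) e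
  | add_comm (e f) : Eqv (.add e f) (.add f e)
  | add_assoc (e f g) : Eqv (.add (.add e f) g) (.add e (.add f g))
  | add_idem (e) : Eqv (.add e e) e
  | one_mul (e) : Eqv (.mul .one e) e
  | mul_one (e) : Eqv (.mul e .one) e
  | zero_mul (e) : Eqv (.mul .zero e) .zero
  | mul_zero (e) : Eqv (.mul e .zero) .zero
  | mul_assoc (e f g) : Eqv (.mul (.mul e f) g) (.mul e (.mul f g))
  | mul_add (e f g) : Eqv (.mul e (.add f g)) (.add (.mul e f) (.mul e g))
  | add_mul (e f g) : Eqv (.mul (.add e f) g) (.add (.mul e g) (.mul f g))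
  | star_unfold (e) : Eqv (.star e) (.add .one (.mul e (.star e)))
  | comm {x y : X} : Commutes x y → Eqv (.mul (.sym x) (.sym y)) (.mul (.sym y) (.sym x))

instance RawTerm.setoid (X : Type u) [CommutableSet X] : Setoid (RawTerm X) where
  r := RawTerm.Eqv
  iseqv := ⟨.refl, .symm, .trans⟩

/-- Terms over a commutable set: the free pre-Kleene algebra. -/
def Term (X : Type u) [CommutableSet X] : Type u := Quotient (RawTerm.setoid X)

namespace Term

variable {X : Type u} {Y : Type v} [CommutableSet X] [CommutableSet Y]

/-- A symbol as a term. -/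
def sym (x : X) : Term X := Quotient.mk _ (.sym x)

instance : Zero (Term X) := ⟨Quotient.mk _ .zero⟩

instance : One (Term X) := ⟨Quotient.mk _ .one⟩

instance : Add (Term X) := ⟨Quotient.map₂ .add fun _ _ h _ _ h' => .congr_add h h'⟩

instance : Mul (Term X) := ⟨Quotient.map₂ .mul fun _ _ h _ _ h' => .congr_mul h h'⟩

instance : Semiring (Term X) where
  add_assoc := by rintro ⟨a⟩ ⟨b⟩ ⟨c⟩; exact Quotient.sound (.add_assoc a b c)
  zero_add := by rintro ⟨a⟩; exact Quotient.sound (.zero_add a)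
  add_zero := by
    rintro ⟨a⟩; exact Quotient.sound (.trans (.add_comm a .zero) (.zero_add a))
  add_comm := by rintro ⟨a⟩ ⟨b⟩; exact Quotient.sound (.add_comm a b)
  left_distrib := by rintro ⟨a⟩ ⟨b⟩ ⟨c⟩; exact Quotient.sound (.mul_add a b c)
  right_distrib := by rintro ⟨a⟩ ⟨b⟩ ⟨c⟩; exact Quotient.sound (.add_mul a b c)
  zero_mul := by rintro ⟨a⟩; exact Quotient.sound (.zero_mul a)
  mul_zero := by rintro ⟨a⟩; exact Quotient.sound (.mul_zero a)
  mul_assoc := by rintro ⟨a⟩ ⟨b⟩ ⟨c⟩; exact Quotient.sound (.mul_assoc a b c)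
  one_mul := by rintro ⟨a⟩; exact Quotient.sound (.one_mul a)
  mul_one := by rintro ⟨a⟩; exact Quotient.sound (.mul_one a)
  nsmul := nsmulRec

instance : PreKleeneAlgebra (Term X) where
  __ := IdemSemiring.ofSemiring (α := Term X)
    (by rintro ⟨a⟩; exact Quotient.sound (.add_idem a))
  kstar := Quotient.map .star fun _ _ h => .congr_star h
  kstar_unfold := by rintro ⟨a⟩; exact Quotient.sound (.star_unfold a)

theorem sym_comm {x y : X} (h : Commutes x y) : sym x * sym y = sym y * sym x :=
  Quotient.sound (.comm h)

section Lift

variable {A : Type w} [PreKleeneAlgebra A]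

/-- The value of an expression in a pre-Kleene algebra. -/
def evalRaw (f : X → A) : RawTerm X → A
  | .sym x => f x
  | .zero => 0
  | .one => 1
  | .add e e' => evalRaw f e + evalRaw f e'
  | .mul e e' => evalRaw f e * evalRaw f e'
  | .star e => (evalRaw f e)∗

theorem evalRaw_eqv (f : X → A) (hf : ∀ x y, Commutes x y → f x * f y = f y * f x)
    {e e' : RawTerm X} (h : e.Eqv e') : evalRaw f e = evalRaw f e' := by
  induction h with
  | refl => rfl
  | symm _ ih => exact ih.symm
  | trans _ _ ih ih' => exact ih.trans ih'
  | congr_add _ _ ih ih' => simp only [evalRaw, ih, ih']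
  | congr_mul _ _ ih ih' => simp only [evalRaw, ih, ih']
  | congr_star _ ih => simp only [evalRaw, ih]
  | zero_add => exact zero_add _
  | add_comm => exact add_comm _ _
  | add_assoc => exact add_assoc _ _ _
  | add_idem => exact add_idem _
  | one_mul => exact one_mul _
  | mul_one => exact mul_one _
  | zero_mul => exact zero_mul _
  | mul_zero => exact mul_zero _
  | mul_assoc => exact mul_assoc _ _ _
  | mul_add => exact mul_add _ _ _
  | add_mul => exact add_mul _ _ _
  | star_unfold => exact PreKleeneAlgebra.kstar_unfold _
  | comm h => exact hf _ _ h

/-- The morphism of pre-Kleene algebras determined by its values on symbols. -/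
def lift (f : X → A) (hf : ∀ x y, Commutes x y → f x * f y = f y * f x) :
    PreKAHom (Term X) A where
  toFun := Quotient.lift (evalRaw f) fun _ _ h => evalRaw_eqv f hf h
  map_zero' := rfl
  map_one' := rfl
  map_add' := by rintro ⟨a⟩ ⟨b⟩; rfl
  map_mul' := by rintro ⟨a⟩ ⟨b⟩; rfl
  map_kstar' := by rintro ⟨a⟩; rfl

theorem lift_sym (f : X → A) (hf : ∀ x y, Commutes x y → f x * f y = f y * f x) (x : X) :
    lift f hf (sym x) = f x := rfl

end Lift

/-- A string as a term. -/
def ofStr : Str X →* Term X := Str.lift sym fun _ _ h => sym_comm h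

/-- A finite set of strings as a term. -/
def ofFinset (L : Finset (Str X)) : Term X := ∑ s ∈ L, ofStr s

/-- The embedding `e ↦ e_l`. -/
def left : PreKAHom (Term X) (Term (X ⊕ Y)) :=
  lift (fun x => sym (.inl x)) (fun _ _ h => sym_comm (X := X ⊕ Y) h)

/-- The embedding `e ↦ e_r`. -/
def right : PreKAHom (Term Y) (Term (X ⊕ Y)) :=
  lift (fun y => sym (.inr y)) (fun _ _ h => sym_comm (X := X ⊕ Y) h)

/-- The projection `π_l`, which maps right symbols to `1`. -/
def projL : PreKAHom (Term (X ⊕ Y)) (Term X) :=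
  lift (Sum.elim sym (fun _ => 1)) (by
    rintro (x | x) (y | y) h
    · exact sym_comm (X := X) h
    all_goals simp only [Sum.elim_inl, Sum.elim_inr, one_mul, mul_one])

/-- The projection `π_r`, which maps left symbols to `1`. -/
def projR : PreKAHom (Term (X ⊕ Y)) (Term Y) :=
  lift (Sum.elim (fun _ => 1) sym) (by
    rintro (x | x) (y | y) h
    · rfl
    · simp only [Sum.elim_inl, Sum.elim_inr, one_mul, mul_one]
    · simp only [Sum.elim_inl, Sum.elim_inr, one_mul, mul_one]
    · exact sym_comm (X := Y) h)

/-- The map `Term X → Term (X ⊕ X)` that replaces every symbol `x` by `x_l x_r`. -/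
def diag : PreKAHom (Term X) (Term (X ⊕ X)) :=
  lift (fun x => sym (.inl x) * sym (.inr x)) (by
    intro x y h
    have hll : Commute (sym (.inl x : X ⊕ X)) (sym (.inl y)) := sym_comm (X := X ⊕ X) h
    have hrr : Commute (sym (.inr x : X ⊕ X)) (sym (.inr y)) := sym_comm (X := X ⊕ X) h
    have hlr : Commute (sym (.inl x : X ⊕ X)) (sym (.inr y)) :=
      sym_comm (X := X ⊕ X) (x := .inl x) (y := .inr y) trivial
    have hrl : Commute (sym (.inr x : X ⊕ X)) (sym (.inl y)) :=
      sym_comm (X := X ⊕ X) (x := .inr x) (y := .inl y) trivial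
    exact (hll.mul_left hrl).mul_right (hlr.mul_left hrr))

/-- The morphism `[-]₀` to the two-element algebra that maps every symbol to `0`. -/
def nullable : PreKAHom (Term X) Two := lift (fun _ => 0) (fun _ _ _ => rfl)

/-! ## Prefix-free, finite-state and bounded-output terms, representable relations -/

/-- No string of the term is a proper prefix of another one. -/
def PrefixFree (L : Term X) : Prop :=
  ∀ s₁ s₂ : Str X, ofStr s₁ ≤ L → ofStr s₂ ≤ L → s₁.IsPrefix s₂ → s₁ = s₂

/-- `δ` is a family of derivatives of `e`. -/
def IsDerivative [Fintype X] (e : Term X) (δ : X → Term X) : Prop :=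
  e = (nullable e).toAlg + ∑ x, sym x * δ x

/-- A finite-state automaton: a finite set of derivable terms that contains `1` and is closed under
finite sums (including the empty one) and under some choice of derivatives. -/
structure IsAutomaton [Fintype X] (S : Set (Term X)) : Prop where
  finite : S.Finite
  one_mem : 1 ∈ S
  zero_mem : 0 ∈ S
  add_mem : ∀ e ∈ S, ∀ f ∈ S, e + f ∈ S
  derivative : ∀ e ∈ S, ∃ δ : X → Term X, IsDerivative e δ ∧ ∀ x, δ x ∈ S

/-- A finite-state term: a state of some finite-state automaton. -/
def FiniteState [Fintype X] (e : Term X) : Prop := ∃ S : Set (Term X), IsAutomaton S ∧ e ∈ S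

/-- The strings of `e` satisfy `|π_r(s)| ≤ (|π_l(s)| + 1) k` for some fanout `k`. -/
def BoundedOutput (e : Term (X ⊕ X)) : Prop :=
  ∃ k : ℕ, ∀ s : Str (X ⊕ X), ofStr s ≤ e →
    (Str.projR s).size ≤ ((Str.projL s).size + 1) * k

/-- The relation `s →_e s'` on strings defined by `e`. -/
def Step (e : Term (X ⊕ X)) (s s' : Str X) : Prop := ofStr (Str.left s * Str.right s') ≤ e

/-- The image of a set of strings by the relation defined by `e`. -/
def Next (e : Term (X ⊕ X)) (L : Set (Str X)) : Set (Str X) := {s' | ∃ s ∈ L, Step e s s'}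

/-- The term `Σ*`, seen as a term over two copies of the alphabet. -/
def sigmaStar (X : Type u) [CommutableSet X] [Fintype X] : Term (X ⊕ X) :=
  diag (∑ x : X, sym x)∗

open Classical in
/-- The term `Σ^≠`, the sum of all `x_l y_r` with `x ≠ y`. -/
noncomputable def sigmaNe (X : Type u) [CommutableSet X] [Fintype X] : Term (X ⊕ X) :=
  ∑ p : X × X with p.1 ≠ p.2, sym (.inl p.1) * sym (.inr p.2)

/-- `e` is a representable relation on `L`. -/
structure IsRepresentable [Fintype X] (L : Term X) (e : Term (X ⊕ X)) : Prop where
  projL_le : projL e ≤ L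
  projR_le : projR e ≤ L
  next_finite : ∀ Λ : Finset (Str X), (Next e (Λ : Set (Str X))).Finite
  residue : ∃ ρ : Term (X ⊕ X), ∀ Λ : Finset (Str X), (∀ s ∈ Λ, ofStr s ≤ L) →
    right (ofFinset Λ) * e ≤
      diag (ofFinset Λ) * right (ofFinset (next_finite Λ).toFinset) +
        sigmaStar X * sigmaNe X * ρ

end Term

/-! ## Two-counter machines -/

/-- The two counters. -/
inductive Counter : Type
  | first
  | second

/-- Instructions over a set of control states. -/
inductive Instr (Q : Type u) : Type u
  | inc (r : Counter) (q : Q)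
  | ite (r : Counter) (q₁ q₂ : Q)
  | halt (x : Fin 2)

/-- Two-counter machines with control states `Q`. -/
structure Machine (Q : Type u) where
  start : Q
  instr : Q → Instr Q

/-- The alphabet of a machine: its control states and the symbols `a`, `b`, `c₀`, `c₁`. -/
inductive Symbol (Q : Type u) : Type u
  | state (q : Q)
  | a
  | b
  | c (x : Fin 2)
  deriving Fintype

/-- Two symbols of a machine commute only if they are equal. -/
instance (Q : Type u) : CommutableSet (Symbol Q) where
  Commutes x y := x = y
  refl _ := rfl
  symm h := h.symm

namespace Machine

open Term

variable {Q : Type u}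

/-- The term over two copies of the alphabet denoted by an instruction. -/
def interp : Instr Q → Term (Symbol Q ⊕ Symbol Q)
  | .inc .first q =>
      right (sym .a) * diag (sym .a)∗ * diag (sym .b)∗ * right (sym (.state q))
  | .inc .second q =>
      diag (sym .a)∗ * right (sym .b) * diag (sym .b)∗ * right (sym (.state q))
  | .ite .first q₁ q₂ =>
      diag (sym .b)∗ * right (sym (.state q₁)) +
        left (sym .a) * diag (sym .a)∗ * diag (sym .b)∗ * right (sym (.state q₂))
  | .ite .second q₁ q₂ =>
      diag (sym .a)∗ * right (sym (.state q₁)) +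
        diag (sym .a)∗ * left (sym .b) * diag (sym .b)∗ * right (sym (.state q₂))
  | .halt x => right (sym (.c x))

variable [Fintype Q]

/-- Running configurations, `C_M = a* b* Q_M`. -/
def runningConfigs (_M : Machine Q) : Term (Symbol Q) :=
  (sym .a)∗ * (sym .b)∗ * ∑ q : Q, sym (.state q)

/-- All configurations, `T_M = C_M + {c₀, c₁}`. -/
def configs (M : Machine Q) : Term (Symbol Q) :=
  M.runningConfigs + (sym (.c 0) + sym (.c 1))

/-- The transition relation `R_M`. -/
def transition (M : Machine Q) : Term (Symbol Q ⊕ Symbol Q) :=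
  ∑ q : Q, interp (M.instr q) * left (sym (.state q))

end Machine

end CommKA

/-! The three kinds of properties use different tools. Prefix freeness and bounded output only
constrain the strings below a term. By soundness of the language model (`accepts_of_le`) it is
enough to inspect the language. A configuration ends in a control state or a result and contains no
other such symbol, so none is a proper prefix of another (`Terminated.eq_of_isPrefix`). The loops of
an instruction write one symbol for each symbol read, so the excess of output over input is bounded
(`Surplus`). Finite-state terms are closed under sums, products and stars of non-nullable terms, all
by one construction (`IsAutomaton.image2_mul_add`).

Representability is an inequality in the free algebra, where a star only has its unfolding law, so
induction runs over the input string. Push `s_r` into `e`: when `e` reads `x_l`, this symbol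
commutes with all right symbols and meets the first symbol `y` of the input. If `x = y`, the pair
becomes a factor `x_l x_r` in front, and the rest of `s` meets the rest of `e`. If `x ≠ y`, the pair
is a summand of `Σ^≠`, and everything behind it goes into `ρ`. `Residue` carries two parameters for
this induction: the output `t` already written, and an arbitrary upper bound `N` of the possible
outputs. `HasResidue` asks for one `ρ` for all terminated inputs. It is preserved by the
constructors of instructions (`inr_mul`, `inl_mul`, `kstar_mul`, `add`), starting from a final left
symbol (`inl`). -/

namespace CommKA

universe u v w

open CommutableSet (Commutes)

/-! ### Order and star unfolding in pre-Kleene algebras. -/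

namespace PreKleeneAlgebra

variable {A : Type u} {B : Type v} [PreKleeneAlgebra A] [PreKleeneAlgebra B]

theorem one_le_kstar (x : A) : 1 ≤ x∗ := by
  rw [kstar_unfold]; exact le_self_add

theorem mul_kstar_le_kstar (x : A) : x * x∗ ≤ x∗ := by
  conv_rhs => rw [kstar_unfold]
  exact le_add_self

theorem le_kstar_mul (x e : A) : e ≤ x∗ * e := by
  simpa using mul_le_mul_left (one_le_kstar x) e

theorem mul_kstar_mul_le (x e : A) : x * (x∗ * e) ≤ x∗ * e := by
  rw [← mul_assoc]; exact mul_le_mul_left (mul_kstar_le_kstar x) e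

theorem kstar_mul_unfold (x e : A) : x∗ * e = e + x * (x∗ * e) := by
  conv_lhs => rw [kstar_unfold, add_mul, one_mul, mul_assoc]

theorem sum_le {ι : Type*} {s : Finset ι} {f : ι → A} {c : A} (h : ∀ i ∈ s, f i ≤ c) :
    ∑ i ∈ s, f i ≤ c :=
  Finset.sum_induction f (· ≤ c) (fun _ _ => add_le) zero_le h

theorem le_sum {ι : Type*} {s : Finset ι} {f : ι → A} {i : ι} (h : i ∈ s) :
    f i ≤ ∑ i ∈ s, f i :=
  Finset.single_le_sum_of_canonicallyOrdered h

theorem map_mono (f : PreKAHom A B) : Monotone f := fun a b h => by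
  rw [← add_eq_right_iff_le] at h ⊢
  rw [← map_add, h]

end PreKleeneAlgebra

/-! ### Strings: induction, size, words, and strings with a single final symbol. -/

namespace Str

variable {X : Type u} {Y : Type v} [CommutableSet X] [CommutableSet Y]

@[elab_as_elim]
theorem induction {p : Str X → Prop} (s : Str X) (one : p 1)
    (cons : ∀ x s, p s → p (sym x * s)) : p s := by
  refine PresentedMonoid.inductionOn s fun w => ?_
  induction w using FreeMonoid.recOn with
  | one => exact one
  | of_mul x w h => exact cons x _ h

@[simp] theorem left_sym (x : X) : left (Y := Y) (sym x) = sym (.inl x) := lift_sym ..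
@[simp] theorem right_sym (y : Y) : right (X := X) (sym y) = sym (.inr y) := lift_sym ..
@[simp] theorem projL_inl (x : X) : projL (Y := Y) (sym (.inl x)) = sym x := lift_sym ..
@[simp] theorem projL_inr (y : Y) : projL (X := X) (sym (.inr y)) = 1 := lift_sym ..
@[simp] theorem projR_inl (x : X) : projR (Y := Y) (sym (.inl x)) = 1 := lift_sym ..
@[simp] theorem projR_inr (y : Y) : projR (X := X) (sym (.inr y)) = sym y := lift_sym ..

@[simp] theorem size_one : size (1 : Str X) = 0 := by simp [size]
@[simp] theorem size_mul (s t : Str X) : size (s * t) = size s + size t := by simp [size]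
@[simp] theorem size_sym (x : X) : size (sym x) = 1 := by simp [size, lift_sym]

@[simp] theorem projL_left (s : Str X) : projL (left (Y := Y) s) = s := by
  induction s using induction with
  | one => simp
  | cons x s h => simp [h]

@[simp] theorem projL_right (s : Str Y) : projL (right (X := X) s) = 1 := by
  induction s using induction with
  | one => simp
  | cons x s h => simp [h]

@[simp] theorem projR_left (s : Str X) : projR (left (Y := Y) s) = 1 := by
  induction s using induction with
  | one => simp
  | cons x s h => simp [h]

@[simp] theorem projR_right (s : Str Y) : projR (right (X := X) s) = s := by
  induction s using induction with
  | one => simp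
  | cons x s h => simp [h]

/-- Every string is the product of a list of symbols whose length is its size, and a finite alphabet
has finitely many lists of bounded length. -/
theorem finite_size_le [Finite X] (n : ℕ) : {s : Str X | s.size ≤ n}.Finite := by
  refine ((List.finite_length_le X n).image fun l => (l.map sym).prod).subset fun s hs => ?_
  have : ∃ l : List X, l.length = s.size ∧ (l.map sym).prod = s := by
    clear hs
    induction s using induction with
    | one => exact ⟨[], by simp⟩
    | cons x s h =>
      obtain ⟨l, h₁, h₂⟩ := h
      exact ⟨x :: l, by simp [h₁, add_comm], by simp [h₂]⟩
  obtain ⟨l, h₁, h₂⟩ := this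
  exact ⟨l, h₁.trans_le hs, h₂⟩

/-- The word of a string, when distinct symbols do not commute. -/
def toWord (hX : ∀ x y : X, Commutes x y → x = y) : Str X →* FreeMonoid X :=
  lift FreeMonoid.of fun x y h => by rw [hX x y h]

theorem toWord_injective (hX : ∀ x y : X, Commutes x y → x = y) :
    Function.Injective (toWord hX) := by
  refine Function.LeftInverse.injective (g := FreeMonoid.lift sym) fun s => ?_
  induction s using induction with
  | one => simp
  | cons x s h => rw [map_mul, map_mul, h, toWord, lift_sym, FreeMonoid.lift_eval_of]

/-- Nonempty strings whose last symbol, and no other one, satisfies `P`. -/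
inductive Terminated (P : X → Prop) : Str X → Prop
  | sym {x : X} (hx : P x) : Terminated P (sym x)
  | cons {x : X} (hx : ¬ P x) {s : Str X} (hs : Terminated P s) : Terminated P (Str.sym x * s)

/-- The final symbol of `s` occurs in `t` at the same position, and `t` has a final symbol only at
its end. -/
theorem Terminated.eq_of_isPrefix (hX : ∀ x y : X, Commutes x y → x = y) {P : X → Prop}
    {s t : Str X} (hs : Terminated P s) (ht : Terminated P t) (h : s.IsPrefix t) : s = t := by
  obtain ⟨u, hu⟩ := h
  -- Discreteness allows passing to free words, whose first letters can be compared and cancelled;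
  -- `t` and `u` stay general for the induction on `s`.
  have key : ∀ s : Str X, Terminated P s → ∀ t, Terminated P t → ∀ u : FreeMonoid X,
      toWord hX t = toWord hX s * u → toWord hX s = toWord hX t := by
    have cons_eq : ∀ (x : X) (s : Str X),
        (toWord hX (Str.sym x * s)).toList = x :: (toWord hX s).toList := fun x s => by
      rw [map_mul, toWord, lift_sym]; rfl
    have sym_eq : ∀ x : X, (toWord hX (Str.sym x)).toList = [x] := fun x => by
      rw [toWord, lift_sym]; rfl
    intro s hs
    induction hs with
    | sym hx =>
      intro t ht u h
      replace h := congrArg FreeMonoid.toList h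
      rw [FreeMonoid.toList_mul, sym_eq] at h
      cases ht with
      | sym hy =>
        rw [sym_eq] at h
        apply FreeMonoid.toList.injective
        simp_all
      | cons hy ht =>
        rw [cons_eq] at h
        simp_all
    | cons hx hs ih =>
      intro t ht u h
      replace h := congrArg FreeMonoid.toList h
      rw [FreeMonoid.toList_mul, cons_eq] at h
      cases ht with
      | sym hy =>
        rw [sym_eq] at h
        simp_all
      | cons hy ht =>
        rw [cons_eq, List.cons_append, List.cons.injEq] at h
        rw [map_mul, map_mul, h.1, ih _ ht u (FreeMonoid.toList.injective h.2)]
  exact toWord_injective hX (key s hs t ht _ (by rw [hu, map_mul]))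

end Str

/-- Sets of elements of a monoid, with the star of a set being the submonoid that it generates. -/
noncomputable instance (M : Type u) [Monoid M] : PreKleeneAlgebra (SetSemiring M) where
  kstar s := Set.up (Submonoid.closure s.down : Set M)
  kstar_unfold s := by
    refine SetSemiring.down.injective (Set.ext fun m => ?_)
    simp only [SetSemiring.down_add, SetSemiring.down_mul, SetSemiring.down_one,
      SetSemiring.down_up, Set.mem_union, Set.mem_one, Set.mem_mul, SetLike.mem_coe]
    constructor
    · intro hm
      induction hm using Submonoid.closure_induction_left with
      | one => exact .inl rfl
      | mul_left x hx y hy _ => exact .inr ⟨x, hx, y, hy, rfl⟩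
    · rintro (rfl | ⟨x, hx, y, hy, rfl⟩)
      · exact one_mem _
      · exact mul_mem (Submonoid.subset_closure hx) hy

/-! ### Terms: languages, automata, output bounds and residues. -/

namespace Term

variable {X : Type u} {Y : Type v} [CommutableSet X] [CommutableSet Y]

/-- The language of a term. -/
noncomputable def lang : PreKAHom (Term X) (SetSemiring (Str X)) :=
  lift (fun x => SetSemiring.singletonMonoidHom (Str.sym x)) fun x y h => by
    rw [← map_mul, ← map_mul, Str.sym_comm h]

/-- `s` belongs to the language of `e`. -/
def Accepts (e : Term X) (s : Str X) : Prop := s ∈ (lang e).down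

@[simp] theorem accepts_zero (s : Str X) : ¬ Accepts 0 s := by
  simp [Accepts]

@[simp] theorem accepts_one {s : Str X} : Accepts 1 s ↔ s = 1 := by
  simp [Accepts]

@[simp] theorem accepts_sym {x : X} {s : Str X} : Accepts (sym x) s ↔ s = Str.sym x :=
  Iff.rfl

@[simp] theorem accepts_add {e f : Term X} {s : Str X} :
    Accepts (e + f) s ↔ Accepts e s ∨ Accepts f s := by
  rw [Accepts, map_add]; rfl

theorem accepts_mul {e f : Term X} {s : Str X} :
    Accepts (e * f) s ↔ ∃ t, Accepts e t ∧ ∃ u, Accepts f u ∧ t * u = s := by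
  rw [Accepts, map_mul]; rfl

theorem accepts_kstar {e : Term X} {s : Str X} :
    Accepts e∗ s ↔ s ∈ Submonoid.closure {t | Accepts e t} := by
  rw [Accepts, PreKAHom.map_kstar]; rfl

theorem accepts_sum {ι : Type*} {I : Finset ι} {e : ι → Term X} {s : Str X} :
    Accepts (∑ i ∈ I, e i) s ↔ ∃ i ∈ I, Accepts (e i) s := by
  classical
  induction I using Finset.induction_on with
  | empty => simp
  | insert i I hi ih => rw [Finset.sum_insert hi, accepts_add, ih]; simp

@[simp] theorem ofStr_sym (x : X) : ofStr (Str.sym x) = sym x := Str.lift_sym ..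

/-- `lang` is monotone, and a string belongs to its own language. This direction suffices where the
goal quantifies over all strings below a term. -/
theorem accepts_of_le {e : Term X} {s : Str X} (h : ofStr s ≤ e) : Accepts e s := by
  refine PreKleeneAlgebra.map_mono lang h ?_
  change Accepts (ofStr s) s
  clear h
  induction s using Str.induction with
  | one => simp
  | cons x s h =>
    rw [map_mul, ofStr_sym, accepts_mul]
    exact ⟨_, rfl, _, h, rfl⟩

/-! ### Languages of terminated strings -/

theorem terminated_of_accepts_kstar_mul {P : X → Prop} {x : X} (hx : ¬ P x) {e : Term X}
    (he : ∀ s, Accepts e s → s.Terminated P) {s : Str X} (h : Accepts ((sym x)∗ * e) s) :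
    s.Terminated P := by
  obtain ⟨t, ht, u, hu, rfl⟩ := accepts_mul.1 h
  rw [accepts_kstar] at ht
  induction ht using Submonoid.closure_induction_left with
  | one => simpa using he u hu
  | mul_left y hy t _ ih =>
    rw [Set.mem_ofPred_eq, accepts_sym] at hy
    rw [hy, mul_assoc]
    exact .cons hx (ih (accepts_mul.2 ⟨t, accepts_kstar.2 ‹_›, u, hu, rfl⟩))

/-! ### Morphisms on symbols and strings -/

@[simp] theorem left_sym (x : X) : left (Y := Y) (sym x) = sym (.inl x) := rfl
@[simp] theorem right_sym (y : Y) : right (X := X) (sym y) = sym (.inr y) := rfl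
@[simp] theorem diag_sym (x : X) : diag (sym x) = sym (.inl x) * sym (.inr x) := rfl
@[simp] theorem projL_inl (x : X) : projL (Y := Y) (sym (.inl x)) = sym x := rfl
@[simp] theorem projL_inr (y : Y) : projL (X := X) (sym (.inr y)) = 1 := rfl
@[simp] theorem projR_inl (x : X) : projR (Y := Y) (sym (.inl x)) = 1 := rfl
@[simp] theorem projR_inr (y : Y) : projR (X := X) (sym (.inr y)) = sym y := rfl
@[simp] theorem nullable_sym (x : X) : nullable (sym x) = 0 := rfl

theorem ofStr_left (s : Str X) : ofStr (Str.left (Y := Y) s) = left (ofStr s) := by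
  induction s using Str.induction with
  | one => simp
  | cons x s h => simp [h]

theorem ofStr_right (s : Str Y) : ofStr (Str.right (X := X) s) = right (ofStr s) := by
  induction s using Str.induction with
  | one => simp
  | cons x s h => simp [h]

/-- This lets a symbol being read move in front of all output and all pending input. -/
theorem commute_inl_right (x : X) (s : Str Y) : Commute (sym (.inl x)) (right (ofStr s)) := by
  induction s using Str.induction with
  | one => simp
  | cons y s h =>
    rw [map_mul, map_mul, ofStr_sym, right_sym]
    exact Commute.mul_right (sym_comm (X := X ⊕ Y) trivial) h

theorem ofStr_le_kstar [Fintype X] (s : Str X) : ofStr s ≤ (∑ x : X, sym x)∗ := by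
  induction s using Str.induction with
  | one => simpa using PreKleeneAlgebra.one_le_kstar _
  | cons x s h =>
    rw [map_mul, ofStr_sym]
    exact (mul_le_mul' (PreKleeneAlgebra.le_sum (f := sym) (Finset.mem_univ x)) h).trans
      (PreKleeneAlgebra.mul_kstar_le_kstar _)

/-! ### Finite-state terms -/

section FiniteState

variable [Fintype X]

theorem toAlg_add {A : Type w} [PreKleeneAlgebra A] (i j : Two) :
    ((i + j).toAlg : A) = i.toAlg + j.toAlg := by
  cases i <;> cases j
  · exact (add_zero _).symm
  · exact (zero_add _).symm
  · exact (add_zero _).symm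
  · exact (add_idem _).symm

theorem toAlg_mul {A : Type w} [PreKleeneAlgebra A] (i j : Two) :
    ((i * j).toAlg : A) = i.toAlg * j.toAlg := by
  cases i
  · exact (zero_mul _).symm
  · exact (one_mul _).symm

theorem isDerivative_zero : IsDerivative (0 : Term X) 0 := by
  have h : (Two.toAlg 0 : Term X) = 0 := rfl
  simp [IsDerivative, h]

theorem isDerivative_one : IsDerivative (1 : Term X) 0 := by
  have h : (Two.toAlg 1 : Term X) = 1 := rfl
  simp [IsDerivative, h]

theorem isDerivative_sym [DecidableEq X] (x : X) :
    IsDerivative (sym x) (fun y => if x = y then 1 else 0) := by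
  have h : ((0 : Two).toAlg : Term X) = 0 := rfl
  simp [IsDerivative, h]

theorem IsDerivative.add {e f : Term X} {δ ε : X → Term X} (he : IsDerivative e δ)
    (hf : IsDerivative f ε) : IsDerivative (e + f) (δ + ε) := by
  rw [IsDerivative] at *
  conv_lhs => rw [he, hf]
  simp only [map_add, toAlg_add, Pi.add_apply, mul_add, Finset.sum_add_distrib]
  abel

theorem IsDerivative.mul {e f : Term X} {δ ε : X → Term X} (he : IsDerivative e δ)
    (hf : IsDerivative f ε) :
    IsDerivative (e * f) (fun x => (nullable e).toAlg * ε x + δ x * f) := by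
  have h : e * f = (nullable e).toAlg * f + ∑ x, sym x * (δ x * f) := by
    conv_lhs => rw [he, add_mul, Finset.sum_mul]
    simp only [mul_assoc]
  have h' : (nullable e).toAlg * f =
      (nullable (e * f)).toAlg + ∑ x, sym x * ((nullable e).toAlg * ε x) := by
    rw [map_mul, toAlg_mul]
    conv_lhs => rw [hf, mul_add, Finset.mul_sum]
    cases nullable e
    · simp [Two.toAlg]
    · simp [Two.toAlg]
  refine (h.trans (congrArg (· + _) h')).trans ?_
  simp only [mul_add, Finset.sum_add_distrib, add_assoc]

/-- Without a constant term, `e` is the sum of the `x δ_x`, so a single unfolding of the star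
exposes a leading symbol in every summand other than `1`. -/
theorem IsDerivative.kstar {e : Term X} {δ : X → Term X} (he : IsDerivative e δ)
    (h : nullable e = 0) : IsDerivative e∗ (fun x => δ x * e∗) := by
  have h₁ : nullable e∗ = Two.one := PreKAHom.map_kstar _ _
  have h₂ : e = ∑ x, sym x * δ x := by
    conv_lhs => rw [he, h]
    exact zero_add _
  rw [IsDerivative, h₁]
  conv_lhs => rw [PreKleeneAlgebra.kstar_unfold]
  conv_lhs => enter [2, 1]; rw [h₂]
  simp only [Finset.sum_mul, mul_assoc]
  rfl

theorem isAutomaton_zero_one : IsAutomaton ({0, 1} : Set (Term X)) where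
  finite := by simp
  one_mem := by simp
  zero_mem := by simp
  add_mem := by
    rintro _ (rfl | rfl) _ (rfl | rfl) <;> simp
  derivative := by
    rintro _ (rfl | rfl)
    · exact ⟨0, isDerivative_zero, by simp⟩
    · exact ⟨0, isDerivative_one, by simp⟩

theorem IsAutomaton.toAlg_mul_mem {S : Set (Term X)} (hS : IsAutomaton S) (i : Two) {e : Term X}
    (he : e ∈ S) : i.toAlg * e ∈ S := by
  cases i
  · simpa [Two.toAlg] using hS.zero_mem
  · simpa [Two.toAlg] using he

/-- A derivative of `s * f + t` is `[s]₀ ε + δ f + δ'`. If each `ε x` is itself of the form `s * f +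
t`, this form is stable. Suitable choices of `f`, `S` and `T` give symbols, sums, products and
stars. -/
theorem IsAutomaton.image2_mul_add {S T : Set (Term X)} (hS : IsAutomaton S) (hT : IsAutomaton T)
    {f : Term X} {ε : X → Term X} (hf : IsDerivative f ε)
    (hε : ∀ x, ∃ s ∈ S, ∃ t ∈ T, s * f + t = ε x) :
    IsAutomaton (Set.image2 (fun s t => s * f + t) S T) where
  finite := hS.finite.image2 _ hT.finite
  one_mem := ⟨0, hS.zero_mem, 1, hT.one_mem, by simp⟩
  zero_mem := ⟨0, hS.zero_mem, 0, hT.zero_mem, by simp⟩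
  add_mem := by
    rintro _ ⟨s, hs, t, ht, rfl⟩ _ ⟨s', hs', t', ht', rfl⟩
    refine ⟨s + s', hS.add_mem _ hs _ hs', t + t', hT.add_mem _ ht _ ht', ?_⟩
    simp only [add_mul]
    abel
  derivative := by
    rintro _ ⟨s, hs, t, ht, rfl⟩
    obtain ⟨δ, hδ, hδS⟩ := hS.derivative s hs
    obtain ⟨δ', hδ', hδT⟩ := hT.derivative t ht
    refine ⟨_, (hδ.mul hf).add hδ', fun x => ?_⟩
    obtain ⟨s', hs', t', ht', h⟩ := hε x
    refine ⟨(nullable s).toAlg * s' + δ x,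
      hS.add_mem _ (hS.toAlg_mul_mem _ hs') _ (hδS x),
      (nullable s).toAlg * t' + δ' x,
      hT.add_mem _ (hT.toAlg_mul_mem _ ht') _ (hδT x), ?_⟩
    simp only [Pi.add_apply, ← h, mul_add, add_mul, mul_assoc]
    abel

theorem finiteState_zero : FiniteState (0 : Term X) :=
  ⟨_, isAutomaton_zero_one, by simp⟩

theorem finiteState_sym (x : X) : FiniteState (sym x) := by
  classical
  refine ⟨_, isAutomaton_zero_one.image2_mul_add isAutomaton_zero_one (isDerivative_sym x)
    fun y => ⟨0, by simp, if x = y then 1 else 0, ?_, by simp⟩, 1, by simp, 0, by simp, by simp⟩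
  split_ifs <;> simp

theorem FiniteState.add {e f : Term X} (he : FiniteState e) (hf : FiniteState f) :
    FiniteState (e + f) := by
  obtain ⟨S, hS, he⟩ := he
  obtain ⟨T, hT, hf⟩ := hf
  exact ⟨_, hS.image2_mul_add hT isDerivative_one fun _ =>
    ⟨0, hS.zero_mem, 0, hT.zero_mem, by simp⟩, e, he, f, hf, by simp⟩

theorem FiniteState.mul {e f : Term X} (he : FiniteState e) (hf : FiniteState f) :
    FiniteState (e * f) := by
  obtain ⟨S, hS, he⟩ := he
  obtain ⟨T, hT, hf⟩ := hf
  obtain ⟨ε, hε, hεT⟩ := hT.derivative f hf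
  exact ⟨_, hS.image2_mul_add hT hε fun x =>
    ⟨0, hS.zero_mem, ε x, hεT x, by simp⟩, e, he, 0, hT.zero_mem, by simp⟩

theorem FiniteState.kstar {e : Term X} (he : FiniteState e) (h : nullable e = 0) :
    FiniteState e∗ := by
  obtain ⟨S, hS, he⟩ := he
  obtain ⟨δ, hδ, hδS⟩ := hS.derivative e he
  exact ⟨_, hS.image2_mul_add isAutomaton_zero_one (hδ.kstar h) fun x =>
    ⟨δ x, hδS x, 0, by simp, by simp⟩, 1, hS.one_mem, 0, by simp, by simp⟩

theorem finiteState_sum {ι : Type*} {I : Finset ι} {e : ι → Term X}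
    (h : ∀ i ∈ I, FiniteState (e i)) : FiniteState (∑ i ∈ I, e i) :=
  Finset.sum_induction e FiniteState (fun _ _ => .add) finiteState_zero h

end FiniteState

/-! ### Bounded output -/

/-- The strings of `e` have at most `k` more right symbols than left symbols. -/
def Surplus (k : ℕ) (e : Term (X ⊕ Y)) : Prop :=
  ∀ s, Accepts e s → (Str.projR s).size ≤ (Str.projL s).size + k

namespace Surplus

variable {k l : ℕ} {e f : Term (X ⊕ Y)}

theorem mono (h : Surplus k e) (hkl : k ≤ l) : Surplus l e := fun s hs =>
  (h s hs).trans (by omega)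

theorem inl (x : X) : Surplus 0 (sym (.inl x) : Term (X ⊕ Y)) := by
  rintro s hs
  rw [accepts_sym] at hs
  simp [hs]

theorem inr (y : Y) : Surplus 1 (sym (.inr y) : Term (X ⊕ Y)) := by
  rintro s hs
  rw [accepts_sym] at hs
  simp [hs]

theorem add (he : Surplus k e) (hf : Surplus k f) : Surplus k (e + f) := fun s hs =>
  (accepts_add.1 hs).elim (he s) (hf s)

theorem mul (he : Surplus k e) (hf : Surplus l f) : Surplus (k + l) (e * f) := by
  intro s hs
  obtain ⟨t, ht, u, hu, rfl⟩ := accepts_mul.1 hs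
  have := he t ht
  have := hf u hu
  simp only [map_mul, Str.size_mul]
  omega

theorem kstar (he : Surplus 0 e) : Surplus 0 e∗ := by
  intro s hs
  rw [accepts_kstar] at hs
  induction hs using Submonoid.closure_induction with
  | mem s hs => exact he s hs
  | one => simp
  | mul s t _ _ hs ht =>
    simp only [map_mul, Str.size_mul]
    omega

theorem sum {ι : Type*} {I : Finset ι} {e : ι → Term (X ⊕ Y)}
    (h : ∀ i ∈ I, Surplus k (e i)) : Surplus k (∑ i ∈ I, e i) := by
  intro s hs
  obtain ⟨i, hi, hs⟩ := accepts_sum.1 hs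
  exact h i hi s hs

theorem boundedOutput {e : Term (X ⊕ X)} (h : Surplus k e) : BoundedOutput e :=
  -- With `m` left symbols, `m + k ≤ (m + 1) * (k + 1)`.
  ⟨k + 1, fun s hs => (h s (accepts_of_le hs)).trans (by nlinarith)⟩

end Surplus

theorem diag_surplus (x : X) : Surplus 0 (sym (.inl x) * sym (.inr x) : Term (X ⊕ X)) := by
  intro s hs
  obtain ⟨t, ht, u, hu, rfl⟩ := accepts_mul.1 hs
  rw [accepts_sym] at ht hu
  simp [ht, hu]

theorem BoundedOutput.next_finite [Finite X] {e : Term (X ⊕ X)} (h : BoundedOutput e)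
    {L : Set (Str X)} (hL : L.Finite) : (Next e L).Finite := by
  obtain ⟨k, hk⟩ := h
  have : Next e L ⊆ ⋃ s ∈ L, {s' | s'.size ≤ (s.size + 1) * k} := by
    rintro s' ⟨s, hs, h⟩
    refine Set.mem_biUnion hs ?_
    simpa using hk _ h
  exact (hL.biUnion fun s _ => Str.finite_size_le _).subset this

/-! ### Residues -/

section Residue

variable [Fintype X]

/-- Reading `s` in `e`, after the output `t`, gives outputs below `N`, up to `ρ`. -/
def Residue (ρ : Term (X ⊕ X)) (s : Str X) (e : Term (X ⊕ X)) : Prop :=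
  ∀ (t : Str X) (N : Term (X ⊕ X)),
    (∀ s' : Str X, left (ofStr s) * right (ofStr s') ≤ right (ofStr t) * e →
      right (ofStr s') ≤ N) →
    right (ofStr s) * (right (ofStr t) * e) ≤
      diag (ofStr s) * N + sigmaStar X * sigmaNe X * ρ

namespace Residue

variable {ρ ρ' e f : Term (X ⊕ X)} {s : Str X}

theorem mono (h : Residue ρ s e) (hρ : ρ ≤ ρ') : Residue ρ' s e := fun t N hN =>
  (h t N hN).trans (by gcongr)

theorem zero : Residue ρ s 0 := fun t N _ => by simp

theorem add (he : Residue ρ s e) (hf : Residue ρ s f) : Residue ρ s (e + f) := by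
  intro t N hN
  rw [mul_add, mul_add]
  refine add_le (he t N fun s' h => hN s' ?_) (hf t N fun s' h => hN s' ?_)
  · exact h.trans (by rw [mul_add]; exact le_self_add)
  · exact h.trans (by rw [mul_add]; exact le_add_self)

theorem sum {ι : Type*} {I : Finset ι} {e : ι → Term (X ⊕ X)}
    (h : ∀ i ∈ I, Residue ρ s (e i)) : Residue ρ s (∑ i ∈ I, e i) :=
  Finset.sum_induction e (Residue ρ s) (fun _ _ => add) zero h

/-- Output written by `e` is appended to the accumulated output `t`; this is why `Residue`
quantifies over `t`. -/
theorem right_mul (u : Str X) (h : Residue ρ s e) : Residue ρ s (right (ofStr u) * e) := by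
  intro t N hN
  have := h (t * u) N
  rw [map_mul, map_mul] at this
  simpa only [mul_assoc] using this (by simpa only [mul_assoc] using hN)

theorem one : Residue ρ 1 (1 : Term (X ⊕ X)) := by
  intro t N hN
  simp only [map_one, one_mul, mul_one] at *
  exact (hN t le_rfl).trans le_self_add

/-- The factor `Σ*` in front of the error term absorbs each matched symbol. -/
theorem diag_mul_le (x : X) :
    diag (sym x) * (sigmaStar X * sigmaNe X * ρ) ≤ sigmaStar X * sigmaNe X * ρ := by
  rw [mul_assoc, ← mul_assoc]
  gcongr
  rw [sigmaStar, ← map_mul]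
  refine PreKleeneAlgebra.map_mono _ (le_trans ?_ (PreKleeneAlgebra.mul_kstar_le_kstar _))
  gcongr
  exact PreKleeneAlgebra.le_sum (f := sym) (Finset.mem_univ x)

theorem inl_mul (x : X) (h : Residue ρ s e) :
    Residue ρ (Str.sym x * s) (sym (.inl x) * e) := by
  intro t N hN
  have hx := commute_inl_right x (Y := X)
  -- An output of the rest is an output of the whole: multiply by `x_l` and commute it past `t_r`.
  have h' := h t N fun s' hs' => hN s' <| by
    rw [map_mul, map_mul, ofStr_sym, left_sym, mul_assoc, ← mul_assoc (right _),
      ← (hx t).eq, mul_assoc]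
    gcongr
  calc right (ofStr (Str.sym x * s)) * (right (ofStr t) * (sym (.inl x) * e))
      = diag (sym x) * (right (ofStr s) * (right (ofStr t) * e)) := by
        rw [← mul_assoc (right (ofStr t)), ← (hx t).eq, mul_assoc, ← mul_assoc, ← (hx _).eq]
        simp only [map_mul, ofStr_sym, right_sym, diag_sym, mul_assoc]
    _ ≤ diag (sym x) * (diag (ofStr s) * N + sigmaStar X * sigmaNe X * ρ) := by gcongr
    _ ≤ _ := by
        rw [mul_add, map_mul, map_mul, ofStr_sym, mul_assoc (diag _) (diag _)]
        exact add_le_add le_rfl (diag_mul_le x)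

/-- On a mismatch `x_l y_r` is a summand of `Σ^≠`. The remaining input and the output are right
strings, hence below `Σ*` on the right, so a single `ρ` serves all `s` and `t`. -/
theorem inl_mul_of_ne {x y : X} (hxy : x ≠ y)
    (h : right (∑ x : X, sym x)∗ * e ≤ ρ) :
    Residue ρ (Str.sym y * s) (sym (.inl x) * e) := by
  intro t N _
  have hx := commute_inl_right x (Y := X)
  calc right (ofStr (Str.sym y * s)) * (right (ofStr t) * (sym (.inl x) * e))
      = 1 * (sym (.inl x) * sym (.inr y)) * (right (ofStr (s * t)) * e) := by
        rw [← mul_assoc (right (ofStr t)), ← (hx t).eq, mul_assoc, ← mul_assoc, ← (hx _).eq]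
        simp only [map_mul, ofStr_sym, right_sym, one_mul, mul_assoc]
    _ ≤ sigmaStar X * sigmaNe X * ρ := by
        refine mul_le_mul' (mul_le_mul' ?_ ?_) (le_trans ?_ h)
        · rw [sigmaStar, PreKAHom.map_kstar]
          exact PreKleeneAlgebra.one_le_kstar _
        · rw [sigmaNe]
          refine PreKleeneAlgebra.le_sum
            (f := fun p : X × X => (sym (.inl p.1) * sym (.inr p.2) : Term (X ⊕ X)))
            (i := (x, y)) ?_
          simpa using hxy
        · gcongr
          exact PreKleeneAlgebra.map_mono _ (ofStr_le_kstar _)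
    _ ≤ _ := le_add_self

end Residue

/-- Some term bounds the residues of all strings terminated by `P`. -/
def HasResidue (P : X → Prop) (e : Term (X ⊕ X)) : Prop :=
  ∃ ρ, ∀ s : Str X, s.Terminated P → Residue ρ s e

namespace HasResidue

variable {P : X → Prop} {e f : Term (X ⊕ X)}

theorem zero : HasResidue P (0 : Term (X ⊕ X)) := ⟨0, fun _ _ => .zero⟩

theorem add (he : HasResidue P e) (hf : HasResidue P f) : HasResidue P (e + f) := by
  obtain ⟨ρ, hρ⟩ := he
  obtain ⟨σ, hσ⟩ := hf
  exact ⟨ρ + σ, fun s hs => ((hρ s hs).mono le_self_add).add ((hσ s hs).mono le_add_self)⟩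

theorem sum {ι : Type*} {I : Finset ι} {e : ι → Term (X ⊕ X)}
    (h : ∀ i ∈ I, HasResidue P (e i)) : HasResidue P (∑ i ∈ I, e i) :=
  Finset.sum_induction e (HasResidue P) (fun _ _ => add) zero h

theorem inr_mul (x : X) (h : HasResidue P e) : HasResidue P (sym (.inr x) * e) := by
  obtain ⟨ρ, hρ⟩ := h
  exact ⟨ρ, fun s hs => by simpa using (hρ s hs).right_mul (Str.sym x)⟩

/-- Base of the construction: reading a final symbol either matches exactly at the end of the input,
with nothing left over, or mismatches at the first symbol. -/
theorem inl {x : X} (hx : P x) : HasResidue P (sym (.inl x)) := by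
  refine ⟨right (∑ x : X, sym x)∗ * 1, fun s hs => ?_⟩
  rw [← mul_one (sym _)]
  cases hs with
  | @sym y hy =>
    rw [← mul_one (Str.sym _)]
    by_cases h : x = y
    · subst h; exact Residue.one.inl_mul x
    · exact .inl_mul_of_ne h le_rfl
  | cons hy _ => exact .inl_mul_of_ne (fun h => hy (h ▸ hx)) le_rfl

/-- Since `x` is not final, a match leaves a shorter input that is still terminated, so the bound
for `e` applies to it. -/
theorem inl_mul {x : X} (hx : ¬ P x) (h : HasResidue P e) :
    HasResidue P (sym (.inl x) * e) := by
  obtain ⟨ρ, hρ⟩ := h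
  refine ⟨ρ + right (∑ x : X, sym x)∗ * e, fun s hs => ?_⟩
  cases hs with
  | sym hy =>
    rw [← mul_one (Str.sym _)]
    exact .inl_mul_of_ne (fun h => hx (h ▸ hy)) le_add_self
  | @cons y hy s hs =>
    by_cases h : x = y
    · subst h; exact ((hρ s hs).mono le_self_add).inl_mul x
    · exact .inl_mul_of_ne h le_add_self

/-- Unfold the star once per input symbol. Leaving the loop is bounded by `ρ`; a matched iteration
is the induction hypothesis; a mismatch is bounded by the second summand of the residue. That
summand contains the loop `f` itself, so it does not depend on the number of iterations. At the last
input symbol, which is final, the loop symbol always mismatches. -/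
theorem kstar_mul {x : X} (hx : ¬ P x) (h : HasResidue P e) :
    HasResidue P ((sym (.inl x) * sym (.inr x))∗ * e) := by
  obtain ⟨ρ, hρ⟩ := h
  set f := (sym (.inl x) * sym (.inr x) : Term (X ⊕ X))∗ * e
  have hf : f = e + sym (.inl x) * (sym (.inr x) * f) := by
    rw [← mul_assoc]; exact PreKleeneAlgebra.kstar_mul_unfold _ _
  refine ⟨ρ + right (∑ x : X, sym x)∗ * (sym (.inr x) * f), fun s hs => ?_⟩
  set σ := ρ + right (∑ x : X, sym x)∗ * (sym (.inr x) * f)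
  have unfold {s} (hs : s.Terminated P)
      (h : Residue σ s (sym (.inl x) * (sym (.inr x) * f))) : Residue σ s f := by
    have := ((hρ s hs).mono (le_self_add : ρ ≤ σ)).add h
    rwa [← hf] at this
  induction hs with
  | sym hy =>
    refine unfold (.sym hy) ?_
    rw [← mul_one (Str.sym _)]
    exact .inl_mul_of_ne (fun h => hx (h ▸ hy)) le_add_self
  | @cons y hy s hs ih =>
    refine unfold (.cons hy hs) ?_
    by_cases h : x = y
    · subst h
      exact Residue.inl_mul x (by simpa using ih.right_mul (Str.sym x))
    · exact .inl_mul_of_ne h le_add_self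

theorem isRepresentable {L : Term X} (hL : ∀ s, ofStr s ≤ L → s.Terminated P)
    (h : HasResidue P e) (hl : projL e ≤ L) (hr : projR e ≤ L) (hb : BoundedOutput e) :
    IsRepresentable L e where
  projL_le := hl
  projR_le := hr
  next_finite Λ := hb.next_finite Λ.finite_toSet
  residue := by
    obtain ⟨ρ, hρ⟩ := h
    refine ⟨ρ, fun Λ hΛ => ?_⟩
    conv_lhs => rw [ofFinset, map_sum, Finset.sum_mul]
    refine PreKleeneAlgebra.sum_le fun s hs => ?_
    -- Start with empty output and take for `N` the sum of all of `Next`, which bounds the outputs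
    -- of each `s` in `Λ`.
    have := hρ s (hL s (hΛ s hs)) 1
      (right (ofFinset (hb.next_finite Λ.finite_toSet).toFinset)) fun s' hs' => by
        refine PreKleeneAlgebra.map_mono _ (PreKleeneAlgebra.le_sum (f := ofStr) ?_)
        rw [Set.Finite.mem_toFinset]
        refine ⟨s, hs, ?_⟩
        rw [Step, map_mul, ofStr_left, ofStr_right]
        simpa using hs'
    simp only [map_one, one_mul] at this
    refine this.trans ?_
    gcongr
    exact PreKleeneAlgebra.map_mono _ (PreKleeneAlgebra.le_sum (f := ofStr) hs)

end HasResidue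

end Residue

end Term

/-! ### The configurations and the transition relation of a machine. -/

namespace Machine

open Term PreKleeneAlgebra

variable {Q : Type u}

/-- Control states and results end the configurations. -/
def IsFinal : Symbol Q → Prop
  | .state _ => True
  | .c _ => True
  | .a => False
  | .b => False

/-- Outside the balanced diagonal loops, an instruction writes at most a counter symbol and a
control state, or a single result; hence `2`. -/
theorem interp_surplus (i : Instr Q) : Surplus 2 (interp i) := by
  have hl (x : Symbol Q) : Surplus 0 (left (sym x) : Term (Symbol Q ⊕ Symbol Q)) := .inl x
  have hr (x : Symbol Q) : Surplus 1 (right (sym x) : Term (Symbol Q ⊕ Symbol Q)) := .inr x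
  have hd (x : Symbol Q) : Surplus 0 (diag (sym x)∗) := (diag_surplus x).kstar
  rcases i with ⟨_ | _, q'⟩ | ⟨_ | _, q₁, q₂⟩ | x
  · exact (((hr _).mul (hd _)).mul (hd _)).mul (hr _)
  · exact (((hd _).mul (hr _)).mul (hd _)).mul (hr _)
  · exact (((hd _).mul (hr _)).add ((((hl _).mul (hd _)).mul (hd _)).mul (hr _))).mono (by simp)
  · exact (((hd _).mul (hr _)).add ((((hd _).mul (hl _)).mul (hd _)).mul (hr _))).mono (by simp)
  · exact (hr _).mono (by simp)

variable [Fintype Q]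

theorem kstar_mul_state_le (M : Machine Q) (q : Q) :
    (sym .a)∗ * ((sym .b)∗ * sym (.state q)) ≤ M.runningConfigs := by
  rw [← mul_assoc, runningConfigs]
  gcongr
  exact le_sum (f := fun q : Q => sym (Symbol.state q)) (Finset.mem_univ q)

theorem runningConfigs_le_configs (M : Machine Q) : M.runningConfigs ≤ M.configs := le_self_add

theorem result_le_configs (M : Machine Q) (x : Fin 2) : sym (.c x) ≤ M.configs := by
  refine le_trans ?_ le_add_self
  fin_cases x
  · exact le_self_add
  · exact le_add_self

theorem terminated_of_le_configs (M : Machine Q) {s : Str (Symbol Q)}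
    (h : ofStr s ≤ M.configs) : s.Terminated IsFinal := by
  have hsym (x : Symbol Q) (hx : IsFinal x) (s : Str (Symbol Q)) (hs : Accepts (sym x) s) :
      s.Terminated IsFinal := by
    rw [accepts_sym.1 hs]
    exact .sym hx
  replace h := accepts_of_le h
  rw [configs, accepts_add, accepts_add, runningConfigs, mul_assoc] at h
  obtain h | h | h := h
  · refine terminated_of_accepts_kstar_mul id (fun s hs => ?_) h
    refine terminated_of_accepts_kstar_mul id (fun s hs => ?_) hs
    obtain ⟨q, -, hs⟩ := accepts_sum.1 hs
    exact hsym (.state q) trivial s hs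
  · exact hsym (.c 0) trivial s h
  · exact hsym (.c 1) trivial s h

theorem configs_prefixFree (M : Machine Q) : M.configs.PrefixFree := fun _ _ h₁ h₂ =>
  (M.terminated_of_le_configs h₁).eq_of_isPrefix (fun _ _ => id) (M.terminated_of_le_configs h₂)

theorem projL_interp_mul_le (M : Machine Q) (i : Instr Q) (q : Q) :
    projL (interp i * left (sym (.state q))) ≤ M.runningConfigs := by
  refine le_trans ?_ (M.kstar_mul_state_le q)
  rcases i with ⟨_ | _, q'⟩ | ⟨_ | _, q₁, q₂⟩ | x
  all_goals
    simp only [interp, map_add, map_mul, PreKAHom.map_kstar, diag_sym, right_sym, left_sym,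
      projL_inl, projL_inr, one_mul, mul_one, add_mul, mul_assoc]
  · exact le_rfl
  · exact le_rfl
  · exact add_le (le_kstar_mul _ _) (mul_kstar_mul_le _ _)
  · exact add_le (mul_le_mul' le_rfl (le_kstar_mul _ _))
      (mul_le_mul' le_rfl (mul_kstar_mul_le _ _))
  · exact (le_kstar_mul _ _).trans (le_kstar_mul _ _)

theorem projR_interp_mul_le (M : Machine Q) (i : Instr Q) (q : Q) :
    projR (interp i * left (sym (.state q))) ≤ M.configs := by
  have hM q := (M.kstar_mul_state_le q).trans M.runningConfigs_le_configs
  rcases i with ⟨_ | _, q'⟩ | ⟨_ | _, q₁, q₂⟩ | x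
  all_goals
    simp only [interp, map_add, map_mul, PreKAHom.map_kstar, diag_sym, right_sym, left_sym,
      projR_inl, projR_inr, one_mul, mul_one, mul_assoc]
  · exact (mul_kstar_mul_le _ _).trans (hM q')
  · exact (mul_le_mul' le_rfl (mul_kstar_mul_le _ _)).trans (hM q')
  · exact add_le ((le_kstar_mul _ _).trans (hM q₁)) (hM q₂)
  · exact add_le ((mul_le_mul' le_rfl (le_kstar_mul _ _)).trans (hM q₁))
      (hM q₂)
  · exact M.result_le_configs x

theorem interp_finiteState (i : Instr Q) : FiniteState (interp i) := by
  have hl (x : Symbol Q) : FiniteState (left (sym x) : Term (Symbol Q ⊕ Symbol Q)) :=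
    finiteState_sym _
  have hr (x : Symbol Q) : FiniteState (right (sym x) : Term (Symbol Q ⊕ Symbol Q)) :=
    finiteState_sym _
  have hd (x : Symbol Q) : FiniteState (diag (sym x)∗) :=
    ((finiteState_sym _).mul (finiteState_sym _)).kstar rfl
  rcases i with ⟨_ | _, q'⟩ | ⟨_ | _, q₁, q₂⟩ | x
  · exact (((hr _).mul (hd _)).mul (hd _)).mul (hr _)
  · exact (((hd _).mul (hr _)).mul (hd _)).mul (hr _)
  · exact ((hd _).mul (hr _)).add ((((hl _).mul (hd _)).mul (hd _)).mul (hr _))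
  · exact ((hd _).mul (hr _)).add ((((hd _).mul (hl _)).mul (hd _)).mul (hr _))
  · exact hr _

/-- Associated to the right, each summand is a chain of single symbols and diagonal loops over `a`
or `b`, ending in the left control state. The closure rules follow this chain from its front to that
final symbol. -/
theorem interp_hasResidue (i : Instr Q) (q : Q) :
    HasResidue IsFinal (interp i * left (sym (.state q))) := by
  have ha : ¬ IsFinal (Symbol.a : Symbol Q) := id
  have hb : ¬ IsFinal (Symbol.b : Symbol Q) := id
  have hq : HasResidue IsFinal (sym (.inl (.state q)) : Term (Symbol Q ⊕ Symbol Q)) :=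
    .inl trivial
  rcases i with ⟨_ | _, q'⟩ | ⟨_ | _, q₁, q₂⟩ | x
  all_goals
    simp only [interp, PreKAHom.map_kstar, diag_sym, right_sym, left_sym,
      add_mul, mul_assoc]
  · exact .inr_mul _ (.kstar_mul ha (.kstar_mul hb (.inr_mul _ hq)))
  · exact .kstar_mul ha (.inr_mul _ (.kstar_mul hb (.inr_mul _ hq)))
  · exact .add (.kstar_mul hb (.inr_mul _ hq))
      (.inl_mul ha (.kstar_mul ha (.kstar_mul hb (.inr_mul _ hq))))
  · exact .add (.kstar_mul ha (.inr_mul _ hq))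
      (.kstar_mul ha (.inl_mul hb (.kstar_mul hb (.inr_mul _ hq))))
  · exact .inr_mul _ hq

theorem projL_transition_le (M : Machine Q) : projL M.transition ≤ M.runningConfigs := by
  rw [transition, map_sum]
  exact sum_le fun q _ => M.projL_interp_mul_le _ q

theorem projR_transition_le (M : Machine Q) : projR M.transition ≤ M.configs := by
  rw [transition, map_sum]
  exact sum_le fun q _ => M.projR_interp_mul_le _ q

theorem transition_finiteState (M : Machine Q) : M.transition.FiniteState :=
  finiteState_sum fun _ _ => (interp_finiteState _).mul (finiteState_sym _)

theorem transition_boundedOutput (M : Machine Q) : M.transition.BoundedOutput :=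
  (Surplus.sum fun _ _ => (interp_surplus _).mul (.inl _)).boundedOutput

theorem transition_isRepresentable (M : Machine Q) : IsRepresentable M.configs M.transition :=
  HasResidue.isRepresentable (fun _ => M.terminated_of_le_configs)
    (.sum fun _ _ => interp_hasResidue _ _)
    (M.projL_transition_le.trans M.runningConfigs_le_configs) M.projR_transition_le
    M.transition_boundedOutput

end Machine

end CommKA

theorem mainTheorem5 {Q : Type*} [Fintype Q] (M : CommKA.Machine Q) :
    M.configs.PrefixFree ∧
    CommKA.Term.projL M.transition ≤ M.runningConfigs ∧
    M.runningConfigs ≤ M.configs ∧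
    CommKA.Term.projR M.transition ≤ M.configs ∧
    M.transition.FiniteState ∧
    M.transition.BoundedOutput ∧
    CommKA.Term.IsRepresentable M.configs M.transition :=
  ⟨M.configs_prefixFree, M.projL_transition_le, M.runningConfigs_le_configs,
    M.projR_transition_le, M.transition_finiteState, M.transition_boundedOutput,
    M.transition_isRepresentable⟩
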